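/- A surreal number is a function $x:\alpha\to\{+,-\}$ with $\alpha$ an ordinal (the length of $x$). The class $\mathbf{No}$ of all surreal numbers is linearly ordered by comparing $x$ and $y$ at the first ordinal where they differ, with $- < \text{undefined} < +$. Write $y\preceq x$ if $y$ is the restriction of $x$ to an ordinal less than or equal to the length of $x$. A subclass $S\subseteq\mathbf{No}$ is called initial if $x\in S$, $y\in\mathbf{No}$ and $y\preceq x$ imply $y\in S$. The class $\mathbf{No}$ carries Conway's field operations: $0$ is the empty sequence, $1=(+)$, $-x$ is obtained from $x$ by reversing all signs, and recursively $$x+y=\langle x^L+y,\;x+y^L \mid x^R+y,\;x+y^R\rangle,$$ $$xy=\langle x^Ly+xy^L-x^Ly^L,\;x^Ry+xy^R-x^Ry^R \mid x^Ly+xy^R-x^Ly^R,\;x^Ry+xy^L-x^Ry^L\rangle,$$ where $x^L$ (resp. $x^R$) ranges over the proper initial segments of $x$ that are smaller (resp. larger) than $x$, similarly for $y$, and $\langle L\mid R\rangle$ is the $\preceq$-least surreal number $z$ with $L<z<R$. Let $S$ and $U$ be initial subclasses of $\mathbf{No}$. Then the following subclasses of $\mathbf{No}$ are also initial: 1. the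 additive subgroup of $\mathbf{No}$ generated by $S$; 2. the (unital) subring of $\mathbf{No}$ generated by $S$; 3. $-S:=\{-x : x\in S\}$; 4. $S+U:=\{x+y : x\in S,\ y\in U\}$; 5. the additive subgroup of $\mathbf{No}$ generated by $SU:=\{xy : x\in S,\ y\in U\}$. -/

import Mathlib

universe u

/-- A surreal number: a sequence of signs indexed by an ordinal, its `length`.  The sequence is
stored as a total function on the ordinals which takes the value `1` (for `+`) or `-1` (for `-`)
at the ordinals below `length`, and the value `0` (for "undefined") at all other ordinals. -/
structure No : Type (u + 1) where
  length : Ordinal.{u}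
  sign : Ordinal.{u} → SignType
  sign_ne_zero_iff : ∀ β, sign β ≠ 0 ↔ β < length

namespace No

theorem sign_injective : Function.Injective No.sign := by
  rintro ⟨α, f, hf⟩ ⟨β, g, hg⟩ h
  obtain rfl : f = g := h
  obtain rfl : α = β :=
    eq_of_forall_lt_iff fun γ => (hf γ).symm.trans (hg γ)
  rfl

/-- The linear order of the surreal numbers: sign sequences are compared at the first place at
which they differ, with `- < undefined < +`. -/
noncomputable instance : LinearOrder No.{u} :=
  LinearOrder.lift' (fun x : No.{u} => toLex x.sign) fun _ _ h => sign_injective (toLex.injective h)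

theorem lt_iff (x y : No.{u}) :
    x < y ↔ ∃ γ, (∀ β < γ, x.sign β = y.sign β) ∧ x.sign γ < y.sign γ :=
  Iff.rfl

/-- `x ≺ y`: `x` is the restriction of `y` to an ordinal strictly smaller than its length. -/
def StrictlySimpler (x y : No.{u}) : Prop :=
  x.length < y.length ∧ ∀ β < x.length, x.sign β = y.sign β

/-- `x ⪯ y`: `x` is an initial segment of `y`, possibly `y` itself. -/
def Simpler (x y : No.{u}) : Prop :=
  x.StrictlySimpler y ∨ x = y

/-- The surreal numbers lying strictly between `L` and `R`. -/
def between (L R : Set No.{u}) : Set No.{u} :=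
  {z | (∀ x ∈ L, x < z) ∧ ∀ y ∈ R, z < y}

open Classical in
/-- `⟨L | R⟩`, the simplest surreal number lying strictly between `L` and `R`
(and the default value with empty sign sequence if there is none). -/
noncomputable def cut (L R : Set No.{u}) : No.{u} :=
  if h : ∃ a ∈ between L R, ∀ z ∈ between L R, a.Simpler z then h.choose
  else ⟨0, fun _ => 0, fun β => by simp⟩

/-- The canonical left options of `x`. -/
def leftOptions (x : No.{u}) : Set No.{u} :=
  {y | y < x ∧ y.StrictlySimpler x}

/-- The canonical right options of `x`. -/
def rightOptions (x : No.{u}) : Set No.{u} :=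
  {y | x < y ∧ y.StrictlySimpler x}

/-- Zero is the empty sequence. -/
noncomputable instance : Zero No.{u} :=
  ⟨⟨0, fun _ => 0, fun β => by simp⟩⟩

/-- One is the sequence of length one with the single sign `+`. -/
noncomputable instance : One No.{u} :=
  ⟨⟨1, fun β => if β < 1 then 1 else 0, fun β => by split_ifs with h <;> simp [h]⟩⟩

/-- The negative of `x` is obtained by reversing all its signs. -/
instance : Neg No.{u} :=
  ⟨fun x => ⟨x.length, fun β => -x.sign β, fun β => by
    rw [← x.sign_ne_zero_iff β]; cases x.sign β <;> decide⟩⟩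

/-- `x + y = ⟨xᴸ + y, x + yᴸ | xᴿ + y, x + yᴿ⟩`. -/
noncomputable def add (x y : No.{u}) : No.{u} :=
  cut (Set.range (fun l : x.leftOptions => add l.1 y) ∪
        Set.range (fun l : y.leftOptions => add x l.1))
      (Set.range (fun r : x.rightOptions => add r.1 y) ∪
        Set.range (fun r : y.rightOptions => add x r.1))
termination_by (x.length, y.length)
decreasing_by
  · exact Prod.Lex.left _ _ l.2.2.1
  · exact Prod.Lex.right _ l.2.2.1
  · exact Prod.Lex.left _ _ r.2.2.1
  · exact Prod.Lex.right _ r.2.2.1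

noncomputable instance : Add No.{u} := ⟨add⟩

noncomputable instance : Sub No.{u} := ⟨fun x y => x + -y⟩

/-- `x * y = ⟨xᴸ y + x yᴸ - xᴸ yᴸ, xᴿ y + x yᴿ - xᴿ yᴿ | xᴸ y + x yᴿ - xᴸ yᴿ, xᴿ y + x yᴸ - xᴿ yᴸ⟩`.
-/
noncomputable def mul (x y : No.{u}) : No.{u} :=
  cut
    (Set.range (fun p : x.leftOptions × y.leftOptions =>
        mul p.1.1 y + mul x p.2.1 - mul p.1.1 p.2.1) ∪
      Set.range (fun p : x.rightOptions × y.rightOptions =>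
        mul p.1.1 y + mul x p.2.1 - mul p.1.1 p.2.1))
    (Set.range (fun p : x.leftOptions × y.rightOptions =>
        mul p.1.1 y + mul x p.2.1 - mul p.1.1 p.2.1) ∪
      Set.range (fun p : x.rightOptions × y.leftOptions =>
        mul p.1.1 y + mul x p.2.1 - mul p.1.1 p.2.1))
termination_by (x.length, y.length)
decreasing_by
  all_goals first
    | exact Prod.Lex.left _ _ p.1.2.2.1
    | exact Prod.Lex.right _ p.2.2.2.1

noncomputable instance : Mul No.{u} := ⟨mul⟩

/-- A class of surreal numbers is initial if it contains, with a number `x`, every `y ⪯ x`. -/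
def IsInitial (S : Set No.{u}) : Prop :=
  ∀ x ∈ S, ∀ y : No.{u}, y.Simpler x → y ∈ S

/-- `T` is an additive subgroup of the surreal numbers. -/
structure IsSubgroup (T : Set No.{u}) : Prop where
  zero_mem : 0 ∈ T
  add_mem : ∀ x ∈ T, ∀ y ∈ T, x + y ∈ T
  neg_mem : ∀ x ∈ T, -x ∈ T

/-- `T` is a (unital) subring of the surreal numbers. -/
structure IsSubring (T : Set No.{u}) : Prop extends IsSubgroup T where
  one_mem : 1 ∈ T
  mul_mem : ∀ x ∈ T, ∀ y ∈ T, x * y ∈ T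

/-- The additive subgroup generated by `S`: the smallest subgroup containing `S`. -/
def subgroupGenerated (S : Set No.{u}) : Set No.{u} :=
  ⋂₀ {T | S ⊆ T ∧ IsSubgroup T}

/-- The subring generated by `S`: the smallest subring containing `S`. -/
def subringGenerated (S : Set No.{u}) : Set No.{u} :=
  ⋂₀ {T | S ⊆ T ∧ IsSubring T}

end No

/-!
Everything rests on one property of the simplest number `x = ⟨L | R⟩`. A proper initial segment `z`
of `x` cannot lie between `L` and `R`, so `z ≤ l < x` for some `l ∈ L` or `x < r ≤ z` for some
`r ∈ R`. As the numbers extending `z` form a convex class, `z` is an initial segment of `l` or of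
`r` (`IsSimplest.exists_of_strictlySimpler`). Hence an initial segment of `x + y` or of `x * y` is
either the whole number or an initial segment of an option in Conway's recursion, and induction
applies. For this, the recursive cuts must be genuine: each left option has to lie below each right
option (`isSimplest_add`, `isSimplest_mul`), and there has to be a number between two small sets
`L < R` (`between_nonempty`). For sums this follows from the inductive hypothesis directly; for
products it takes the fact that the numbers form an ordered abelian group under addition.
Associativity and distributivity of the multiplication are not needed.

For the generated subgroup or subring `G`, consider the largest initial class contained in `G`
(`initialCore`). The result on sums, applied to the sets of initial segments of two numbers,
shows that it is again a subgroup, and the result on products shows in the same way that it is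
again a subring. If it contains the generators, it is therefore all of `G`, which is thus initial.
For the products of elements of `S` and `U`, the generators are in it by induction, because the
options of `x * y` are built by group operations from products `a * b` with `a`, `b` initial
segments of `x`, `y`, not both of them the whole number.
-/

namespace No

/-! ### Order and simplicity -/

variable {x y z w : No.{u}} {L R L' R' : Set No.{u}}

theorem ext_sign (h : ∀ β, x.sign β = y.sign β) : x = y :=
  sign_injective (funext h)

theorem sign_eq_zero_iff {β : Ordinal.{u}} : x.sign β = 0 ↔ x.length ≤ β := by
  rw [← not_lt, ← x.sign_ne_zero_iff, not_not]

theorem sign_le_of_le {γ : Ordinal.{u}} (hxy : x ≤ y) (h : ∀ β < γ, x.sign β = y.sign β) :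
    x.sign γ ≤ y.sign γ := by
  by_contra! hlt
  exact hxy.not_gt ((lt_iff _ _).2 ⟨γ, fun β hβ => (h β hβ).symm, hlt⟩)

theorem simpler_iff : x.Simpler y ↔ ∀ β < x.length, x.sign β = y.sign β := by
  refine ⟨?_, fun h => ?_⟩
  · rintro (h | rfl)
    exacts [h.2, fun _ _ => rfl]
  · rcases lt_or_ge x.length y.length with hl | hl
    · exact .inl ⟨hl, h⟩
    · refine .inr (ext_sign fun β => ?_)
      rcases lt_or_ge β x.length with hβ | hβ
      · exact h β hβ
      · rw [sign_eq_zero_iff.2 hβ, sign_eq_zero_iff.2 (hl.trans hβ)]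

theorem Simpler.refl (x : No.{u}) : x.Simpler x := .inr rfl

theorem Simpler.length_le (h : x.Simpler y) : x.length ≤ y.length := by
  rcases h with h | rfl
  exacts [h.1.le, le_rfl]

theorem Simpler.trans (h : x.Simpler y) (h' : y.Simpler z) : x.Simpler z := by
  rw [simpler_iff] at *
  exact fun β hβ => (h β hβ).trans (h' β (hβ.trans_le (simpler_iff.2 h).length_le))

theorem Simpler.antisymm (h : x.Simpler y) (h' : y.Simpler x) : x = y :=
  h.resolve_left fun h => h.1.not_ge h'.length_le

/-- The initial segments of a number form a chain. -/
theorem Simpler.total (hx : x.Simpler z) (hy : y.Simpler z) : x.Simpler y ∨ y.Simpler x := by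
  rw [simpler_iff] at hx hy
  rcases le_total x.length y.length with h | h
  · exact .inl (simpler_iff.2 fun β hβ => (hx β hβ).trans (hy β (hβ.trans_le h)).symm)
  · exact .inr (simpler_iff.2 fun β hβ => (hy β hβ).trans (hx β (hβ.trans_le h)).symm)

/-- The numbers extending `x` form a convex class. -/
theorem Simpler.of_mem_uIcc (h : x.Simpler w) (hz : z ∈ Set.uIcc x w) : x.Simpler z := by
  rw [simpler_iff] at *
  intro β
  induction β using WellFoundedLT.induction with
  | _ β ih =>
    intro hβ
    have ih' : ∀ γ < β, x.sign γ = z.sign γ := fun γ hγ => ih γ hγ (hγ.trans hβ)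
    have hw : ∀ γ < β, z.sign γ = w.sign γ := fun γ hγ => (ih' γ hγ).symm.trans (h γ (hγ.trans hβ))
    rcases Set.mem_uIcc.1 hz with ⟨h₁, h₂⟩ | ⟨h₁, h₂⟩
    · exact (sign_le_of_le h₁ ih').antisymm (h β hβ ▸ sign_le_of_le h₂ hw)
    · exact le_antisymm (h β hβ ▸ sign_le_of_le h₁ fun γ hγ => (hw γ hγ).symm)
        (sign_le_of_le h₂ fun γ hγ => (ih' γ hγ).symm)

theorem induction_strictlySimpler {p : No.{u} → Prop}
    (h : ∀ x, (∀ y : No.{u}, y.StrictlySimpler x → p y) → p x) (x : No.{u}) : p x :=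
  (InvImage.wf No.length Ordinal.lt_wf).induction x fun x ih => h x fun y hy => ih y hy.1

/-- The restriction of `x` to the ordinals below `γ`. -/
noncomputable def restrict (x : No.{u}) (γ : Ordinal.{u}) : No.{u} where
  length := min γ x.length
  sign β := if β < γ then x.sign β else 0
  sign_ne_zero_iff _ := by
    split_ifs with h <;> simp [h, x.sign_ne_zero_iff]

theorem restrict_simpler (x : No.{u}) (γ : Ordinal.{u}) : (x.restrict γ).Simpler x :=
  simpler_iff.2 fun _ hβ => if_pos (hβ.trans_le (min_le_left _ _))

theorem restrict_of_length_le {γ : Ordinal.{u}} (h : x.length ≤ γ) : x.restrict γ = x :=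
  ext_sign fun _ => ite_eq_left_iff.2 fun hβ =>
    (sign_eq_zero_iff.2 (h.trans (not_lt.1 hβ))).symm

theorem le_restrict {γ : Ordinal.{u}} (h : x.sign γ ≤ 0) : x ≤ x.restrict γ := by
  rcases h.lt_or_eq with h | h
  · exact le_of_lt ((lt_iff _ _).2
      ⟨γ, fun β hβ => (if_pos hβ).symm, h.trans_eq (if_neg (lt_irrefl γ)).symm⟩)
  · rw [restrict_of_length_le (sign_eq_zero_iff.1 h)]

theorem restrict_le {γ : Ordinal.{u}} (h : 0 ≤ x.sign γ) : x.restrict γ ≤ x := by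
  rcases h.lt_or_eq with h | h
  · exact le_of_lt ((lt_iff _ _).2
      ⟨γ, fun β hβ => if_pos hβ, (if_neg (lt_irrefl γ)).trans_lt h⟩)
  · rw [restrict_of_length_le (sign_eq_zero_iff.1 h.symm)]

/-- Two numbers have a common initial segment lying between them, namely the longest one. -/
theorem exists_simpler_between (h : x < y) :
    ∃ c : No.{u}, c.Simpler x ∧ c.Simpler y ∧ x ≤ c ∧ c ≤ y := by
  obtain ⟨γ, hγ, hlt⟩ := (lt_iff _ _).1 h
  have e : x.restrict γ = y.restrict γ := ext_sign fun β => by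
    by_cases hβ : β < γ <;> simp [restrict, hβ, hγ]
  have hs : x.sign γ ≤ 0 ∧ 0 ≤ y.sign γ := by
    revert hlt; generalize x.sign γ = a; generalize y.sign γ = b; decide +revert
  exact ⟨x.restrict γ, restrict_simpler _ _, e ▸ restrict_simpler _ _, le_restrict hs.1,
    e ▸ restrict_le hs.2⟩

theorem Simpler.eq_or_mem_rightOptions (h : y.Simpler x) (hle : x ≤ y) :
    y = x ∨ y ∈ x.rightOptions :=
  h.symm.imp_right fun hs => ⟨hle.lt_of_ne fun e => hs.1.ne (e ▸ rfl), hs⟩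

theorem Simpler.eq_or_mem_leftOptions (h : y.Simpler x) (hle : y ≤ x) :
    y = x ∨ y ∈ x.leftOptions :=
  h.symm.imp_right fun hs => ⟨hle.lt_of_ne fun e => hs.1.ne (e ▸ rfl), hs⟩

instance small_strictlySimpler (x : No.{u}) : Small.{u} {y : No.{u} | y.StrictlySimpler x} :=
  small_subset (s := Set.range fun γ : Set.Iio x.length => x.restrict γ.1) fun y hy =>
    ⟨⟨y.length, hy.1⟩, ext_sign fun β => by
      by_cases hβ : β < y.length
      · simp [restrict, hβ, hy.2]
      · simp [restrict, hβ, sign_eq_zero_iff.2 (not_lt.1 hβ)]⟩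

instance small_leftOptions (x : No.{u}) : Small.{u} x.leftOptions :=
  small_subset (s := {y : No.{u} | y.StrictlySimpler x}) fun _ hy => hy.2

instance small_rightOptions (x : No.{u}) : Small.{u} x.rightOptions :=
  small_subset (s := {y : No.{u} | y.StrictlySimpler x}) fun _ hy => hy.2

/-! ### The simplest number between two sets -/

/-- `x` is the simplest number lying strictly between `L` and `R`. -/
def IsSimplest (x : No.{u}) (L R : Set No.{u}) : Prop :=
  x ∈ between L R ∧ ∀ z ∈ between L R, x.Simpler z

theorem exists_isSimplest (h : (between L R).Nonempty) : ∃ x, IsSimplest x L R := by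
  obtain ⟨a, ha, hmin⟩ := (InvImage.wf No.length Ordinal.lt_wf).has_min _ h
  refine ⟨a, ha, fun z hz => ?_⟩
  -- a common initial segment of `a` and `z` between them again lies between `L` and `R`
  have key : ∃ c : No.{u}, c.Simpler a ∧ c.Simpler z ∧ c ∈ between L R := by
    rcases lt_trichotomy a z with h | rfl | h
    · obtain ⟨c, h₁, h₂, h₃, h₄⟩ := exists_simpler_between h
      exact ⟨c, h₁, h₂, fun l hl => (ha.1 l hl).trans_le h₃, fun r hr => h₄.trans_lt (hz.2 r hr)⟩
    · exact ⟨a, .refl _, .refl _, ha⟩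
    · obtain ⟨c, h₁, h₂, h₃, h₄⟩ := exists_simpler_between h
      exact ⟨c, h₂, h₁, fun l hl => (hz.1 l hl).trans_le h₃, fun r hr => h₄.trans_lt (ha.2 r hr)⟩
  obtain ⟨c, hca, hcz, hc⟩ := key
  rcases hca with hca | rfl
  exacts [(hmin c hc hca.1).elim, hcz]

open Classical in
/-- A sign sequence indexed by all ordinals which lies above `L` and below every strict upper bound
of `L`: the next sign is `+` exactly if the signs chosen so far, taken as a number, do not exceed
some element of `L` that begins with them. -/
noncomputable def separator (L : Set No.{u}) (γ : Ordinal.{u}) : SignType :=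
  if ∃ l ∈ L, (∀ β, β < γ → l.sign β = separator L β) ∧ 0 ≤ l.sign γ then 1 else -1
termination_by γ

theorem separator_ne_zero (L : Set No.{u}) (γ : Ordinal.{u}) : separator L γ ≠ 0 := by
  rw [separator]; split_ifs <;> decide

/-- Between two small sets with `L < R` there is a number. -/
theorem between_nonempty [Small.{u} L] [Small.{u} R] (h : ∀ l ∈ L, ∀ r ∈ R, l < r) :
    (between L R).Nonempty := by
  obtain ⟨lam, hlam⟩ : BddAbove (No.length '' (L ∪ R)) := Ordinal.bddAbove_of_small
  let c : No.{u} := ⟨Order.succ lam, fun γ => if γ < Order.succ lam then separator L γ else 0,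
    fun γ => by split_ifs with h <;> simpa [separator_ne_zero] using h⟩
  have hc : ∀ {γ}, γ ≤ lam → c.sign γ = separator L γ := fun hγ => if_pos (Order.lt_succ_of_le hγ)
  -- `c` is longer than the elements of `L ∪ R`, so it differs from them at a place of its domain
  have first : ∀ x ∈ L ∪ R, ∃ γ, c.sign γ = separator L γ ∧ x.sign γ ≠ separator L γ ∧
      ∀ β < γ, x.sign β = separator L β ∧ c.sign β = separator L β := by
    intro x hx
    have hlen : x.length ≤ lam := hlam ⟨x, hx, rfl⟩
    have hne : x.sign x.length ≠ separator L x.length := by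
      rw [sign_eq_zero_iff.2 le_rfl]; exact (separator_ne_zero _ _).symm
    obtain ⟨γ, hγ, hmin⟩ := Ordinal.lt_wf.has_min {γ | x.sign γ ≠ separator L γ} ⟨_, hne⟩
    have hle : γ ≤ lam := (not_lt.1 (hmin _ hne)).trans hlen
    exact ⟨γ, hc hle, hγ, fun β hβ => ⟨not_not.1 fun h => hmin β h hβ, hc (hβ.le.trans hle)⟩⟩
  refine ⟨c, fun l hl => ?_, fun r hr => ?_⟩
  · obtain ⟨γ, h₁, h₂, h₃⟩ := first l (.inl hl)
    refine (lt_iff _ _).2 ⟨γ, fun β hβ => (h₃ β hβ).1.trans (h₃ β hβ).2.symm, ?_⟩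
    rw [h₁]
    have : 0 ≤ l.sign γ → separator L γ = 1 := fun h0 => by
      rw [separator, if_pos ⟨l, hl, fun β hβ => (h₃ β hβ).1, h0⟩]
    revert h₂ this
    generalize l.sign γ = a; generalize separator L γ = b
    decide +revert
  · obtain ⟨γ, h₁, h₂, h₃⟩ := first r (.inr hr)
    refine (lt_iff _ _).2 ⟨γ, fun β hβ => (h₃ β hβ).2.trans (h₃ β hβ).1.symm, ?_⟩
    rw [h₁]
    by_cases hp : ∃ l ∈ L, (∀ β, β < γ → l.sign β = separator L β) ∧ 0 ≤ l.sign γ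
    -- a `+` at `γ` comes from some `l` beginning like `r`; as `r` does not have a `+` there,
    -- `l < r` leaves only the sign `0` for both
    · exfalso
      obtain ⟨l, hl, hlγ, h0⟩ := hp
      have h1 : separator L γ = 1 := by rw [separator, if_pos ⟨l, hl, hlγ, h0⟩]
      have hlr := sign_le_of_le (h l hl r hr).le fun β hβ => (hlγ β hβ).trans (h₃ β hβ).1.symm
      have hz : l.sign γ = 0 ∧ r.sign γ = 0 := by
        revert h₂ hlr h0; rw [h1]
        generalize l.sign γ = a; generalize r.sign γ = b
        decide +revert
      -- both `l` and `r` end at `γ`, so that they coincide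
      refine (h l hl r hr).ne (ext_sign fun β => ?_)
      rcases lt_or_ge β γ with hβ | hβ
      · exact (hlγ β hβ).trans (h₃ β hβ).1.symm
      · rw [sign_eq_zero_iff.2 ((sign_eq_zero_iff.1 hz.1).trans hβ),
          sign_eq_zero_iff.2 ((sign_eq_zero_iff.1 hz.2).trans hβ)]
    · have h1 : separator L γ = -1 := by rw [separator, if_neg hp]
      revert h₂; rw [h1]; generalize r.sign γ = a; decide +revert

theorem isSimplest_cut [Small.{u} L] [Small.{u} R] (h : ∀ l ∈ L, ∀ r ∈ R, l < r) :
    IsSimplest (cut L R) L R := by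
  have hex : ∃ a ∈ between L R, ∀ z ∈ between L R, a.Simpler z :=
    exists_isSimplest (between_nonempty h)
  rw [cut, dif_pos hex]
  exact hex.choose_spec

/-- Two simplest numbers agree if each of them lies on the right sides of the other's bounds. -/
theorem IsSimplest.eq (hx : IsSimplest x L R) (hy : IsSimplest y L' R') (hxy : x ∈ between L' R')
    (hyx : y ∈ between L R) : x = y :=
  (hx.2 y hyx).antisymm (hy.2 x hxy)

theorem isSimplest_options (x : No.{u}) : IsSimplest x x.leftOptions x.rightOptions := by
  refine ⟨⟨fun l hl => hl.1, fun r hr => hr.1⟩, fun z hz => ?_⟩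
  rcases lt_trichotomy x z with h | rfl | h
  · obtain ⟨c, h₁, h₂, h₃, h₄⟩ := exists_simpler_between h
    rcases h₁.eq_or_mem_rightOptions h₃ with rfl | h
    exacts [h₂, ((hz.2 _ h).not_ge h₄).elim]
  · exact .refl _
  · obtain ⟨c, h₁, h₂, h₃, h₄⟩ := exists_simpler_between h
    rcases h₂.eq_or_mem_leftOptions h₄ with rfl | h
    exacts [h₁, ((hz.1 _ h).not_ge h₃).elim]

/-- A proper initial segment of the simplest number between `L` and `R` fails to lie between `L`
and `R`, and is therefore an initial segment of an element of `L` or `R`, by convexity. -/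
theorem IsSimplest.exists_of_strictlySimpler (hx : IsSimplest x L R) (hz : z.StrictlySimpler x) :
    (∃ l ∈ L, z ≤ l ∧ z.Simpler l) ∨ ∃ r ∈ R, r ≤ z ∧ z.Simpler r := by
  by_cases hb : z ∈ between L R
  · exact (hz.1.not_ge (hx.2 z hb).length_le).elim
  · simp only [between, Set.mem_ofPred_eq, not_and_or, not_forall, not_lt] at hb
    rcases hb with ⟨l, hl, hle⟩ | ⟨r, hr, hle⟩
    · exact .inl ⟨l, hl, hle, Simpler.of_mem_uIcc (.inl hz)
        (Set.mem_uIcc.2 (.inl ⟨hle, (hx.1.1 l hl).le⟩))⟩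
    · exact .inr ⟨r, hr, hle, Simpler.of_mem_uIcc (.inl hz)
        (Set.mem_uIcc.2 (.inr ⟨(hx.1.2 r hr).le, hle⟩))⟩

/-- Every canonical left option of `x` is dominated by a lower bound in any representation of `x`. -/
theorem IsSimplest.exists_le_of_mem_leftOptions (hx : IsSimplest x L R)
    (hz : z ∈ x.leftOptions) : ∃ l ∈ L, z ≤ l := by
  rcases hx.exists_of_strictlySimpler hz.2 with ⟨l, hl, hle, -⟩ | ⟨r, hr, hle, -⟩
  exacts [⟨l, hl, hle⟩, ((hle.trans_lt hz.1).asymm (hx.1.2 r hr)).elim]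

/-- Every canonical right option of `x` dominates an upper bound in any representation of `x`. -/
theorem IsSimplest.exists_le_of_mem_rightOptions (hx : IsSimplest x L R)
    (hz : z ∈ x.rightOptions) : ∃ r ∈ R, r ≤ z := by
  rcases hx.exists_of_strictlySimpler hz.2 with ⟨l, hl, hle, -⟩ | ⟨r, hr, hle, -⟩
  exacts [((hz.1.trans_le hle).asymm (hx.1.1 l hl)).elim, ⟨r, hr, hle⟩]

/-! ### Negation -/

theorem simpler_zero_iff : z.Simpler 0 ↔ z = 0 := by
  refine ⟨fun h => h.resolve_left fun h => ?_, fun h => .inr h⟩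
  exact (not_lt_zero : ¬ z.length < 0) h.1

theorem zero_simpler (z : No.{u}) : (0 : No.{u}).Simpler z :=
  simpler_iff.2 fun _ hβ => ((not_lt_zero : ¬ _ < (0 : Ordinal.{u})) hβ).elim

theorem simpler_one_iff : z.Simpler 1 ↔ z = 0 ∨ z = 1 := by
  refine ⟨Or.imp_left fun h => ?_, ?_⟩
  · have : z.length = 0 := Order.lt_one_iff.1 h.1
    exact simpler_zero_iff.1 (simpler_iff.2 fun β hβ => (not_lt_zero (this ▸ hβ : β < 0)).elim)
  · rintro (rfl | rfl)
    exacts [zero_simpler _, .refl _]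

instance : InvolutiveNeg No.{u} where
  neg_neg x := ext_sign fun β => neg_neg (x.sign β)

theorem neg_lt_neg_of_lt (h : x < y) : -y < -x := by
  obtain ⟨γ, hγ, hlt⟩ := (lt_iff _ _).1 h
  refine (lt_iff _ _).2 ⟨γ, fun β hβ => congrArg (- ·) (hγ β hβ).symm, ?_⟩
  change -y.sign γ < -x.sign γ
  revert hlt; generalize x.sign γ = a; generalize y.sign γ = b; decide +revert

theorem Simpler.neg (h : x.Simpler y) : (-x).Simpler (-y) :=
  simpler_iff.2 fun β hβ => congrArg Neg.neg (simpler_iff.1 h β hβ)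

theorem StrictlySimpler.neg (h : x.StrictlySimpler y) : (-x).StrictlySimpler (-y) :=
  ⟨h.1, fun β hβ => congrArg Neg.neg (h.2 β hβ)⟩

theorem neg_mem_rightOptions (h : y ∈ (-x).leftOptions) : -y ∈ x.rightOptions :=
  ⟨by simpa using neg_lt_neg_of_lt h.1, by simpa using h.2.neg⟩

theorem neg_mem_leftOptions (h : y ∈ (-x).rightOptions) : -y ∈ x.leftOptions :=
  ⟨by simpa using neg_lt_neg_of_lt h.1, by simpa using h.2.neg⟩

/-! ### The ordered group of surreal numbers -/

/-- The left options in the recursion for `x + y`. -/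
def addLeft (x y : No.{u}) : Set No.{u} :=
  (fun l => l + y) '' x.leftOptions ∪ (fun l => x + l) '' y.leftOptions

/-- The right options in the recursion for `x + y`. -/
def addRight (x y : No.{u}) : Set No.{u} :=
  (fun r => r + y) '' x.rightOptions ∪ (fun r => x + r) '' y.rightOptions

theorem add_eq_cut (x y : No.{u}) : x + y = cut (addLeft x y) (addRight x y) := by
  change add x y = _
  rw [add, addLeft, addRight]
  simp only [Set.image_eq_range]
  rfl

theorem mem_between_add : z ∈ between (addLeft x y) (addRight x y) ↔
    ((∀ l ∈ x.leftOptions, l + y < z) ∧ ∀ l ∈ y.leftOptions, x + l < z) ∧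
      (∀ r ∈ x.rightOptions, z < r + y) ∧ ∀ r ∈ y.rightOptions, z < x + r := by
  simp only [between, addLeft, addRight, Set.mem_union, Set.mem_image, Set.mem_ofPred_eq,
    or_imp, forall_and, forall_exists_index, and_imp, forall_apply_eq_imp_iff₂]

/-- Initial segments of the same number are comparable for simplicity, so that of two different
ones one is an option of the other. -/
theorem mem_options_of_lt {a b : No.{u}} (ha : a.Simpler x) (hb : b.Simpler x) (h : a < b) :
    a ∈ b.leftOptions ∨ b ∈ a.rightOptions := by
  rcases ha.total hb with hs | hs
  · exact .inl ((hs.eq_or_mem_leftOptions h.le).resolve_left h.ne)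
  · exact .inr ((hs.eq_or_mem_rightOptions h.le).resolve_left h.ne')

theorem isSimplest_add (x y : No.{u}) : IsSimplest (x + y) (addLeft x y) (addRight x y) := by
  induction x using induction_strictlySimpler generalizing y with
  | _ x ihx =>
  induction y using induction_strictlySimpler with
  | _ y ihy =>
  have hx := fun a (ha : a.StrictlySimpler x) b => mem_between_add.1 (ihx a ha b).1
  have hy := fun b (hb : b.StrictlySimpler y) => mem_between_add.1 (ihy b hb).1
  rw [add_eq_cut]
  have : Small.{u} (addLeft x y) := by unfold addLeft; infer_instance
  have : Small.{u} (addRight x y) := by unfold addRight; infer_instance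
  refine isSimplest_cut ?_
  rintro _ (⟨l, hl, rfl⟩ | ⟨l, hl, rfl⟩) _ (⟨r, hr, rfl⟩ | ⟨r, hr, rfl⟩)
  · rcases mem_options_of_lt (.inl hl.2) (.inl hr.2) (hl.1.trans hr.1) with h | h
    exacts [(hx r hr.2 y).1.1 l h, (hx l hl.2 y).2.1 r h]
  · exact ((hx l hl.2 y).2.2 r hr).trans ((hy r hr.2).1.1 l hl)
  · exact ((hy l hl.2).2.1 r hr).trans ((hx r hr.2 y).1.2 l hl)
  · rcases mem_options_of_lt (.inl hl.2) (.inl hr.2) (hl.1.trans hr.1) with h | h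
    exacts [(hy r hr.2).1.2 l h, (hy l hl.2).2.2 r h]

theorem add_lt_add_of_lt (h : x < y) (z : No.{u}) : x + z < y + z := by
  obtain ⟨c, h₁, h₂, h₃, h₄⟩ := exists_simpler_between h
  rcases h₁.eq_or_mem_rightOptions h₃ with rfl | hx
  · exact (mem_between_add.1 (isSimplest_add y z).1).1.1 c
      ((h₂.eq_or_mem_leftOptions h₄).resolve_left h.ne)
  · have hc := (mem_between_add.1 (isSimplest_add x z).1).2.1 c hx
    rcases h₂.eq_or_mem_leftOptions h₄ with rfl | hy
    exacts [hc, hc.trans ((mem_between_add.1 (isSimplest_add y z).1).1.1 c hy)]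

theorem leftOptions_zero : (0 : No.{u}).leftOptions = ∅ :=
  Set.eq_empty_of_forall_notMem fun _ h => (not_lt_zero : ¬ _ < (0 : Ordinal.{u})) h.2.1

theorem rightOptions_zero : (0 : No.{u}).rightOptions = ∅ :=
  Set.eq_empty_of_forall_notMem fun _ h => (not_lt_zero : ¬ _ < (0 : Ordinal.{u})) h.2.1

protected theorem add_comm (x y : No.{u}) : x + y = y + x := by
  induction x using induction_strictlySimpler generalizing y with
  | _ x ihx =>
  induction y using induction_strictlySimpler with
  | _ y ihy =>
  rw [add_eq_cut, add_eq_cut, addLeft, addRight, addLeft, addRight, Set.union_comm,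
    Set.union_comm (_ '' x.rightOptions)]
  congr 2 <;> refine Set.image_congr fun a ha => ?_
  exacts [ihy a ha.2, ihx a ha.2 y, ihy a ha.2, ihx a ha.2 y]

theorem addLeft_comm (x y : No.{u}) : addLeft x y = addLeft y x := by
  simp only [addLeft, No.add_comm x, No.add_comm _ y, Set.union_comm]

theorem addRight_comm (x y : No.{u}) : addRight x y = addRight y x := by
  simp only [addRight, No.add_comm x, No.add_comm _ y, Set.union_comm]

theorem add_lt_add_of_lt' (h : x < y) (z : No.{u}) : z + x < z + y := by
  rw [No.add_comm z, No.add_comm z]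
  exact add_lt_add_of_lt h z

protected theorem add_zero (x : No.{u}) : x + 0 = x := by
  induction x using induction_strictlySimpler with
  | _ x ih =>
  refine (isSimplest_add x 0).eq (isSimplest_options x) ?_ ?_
  · have h := mem_between_add.1 (isSimplest_add x 0).1
    exact ⟨fun l hl => ih l hl.2 ▸ h.1.1 l hl, fun r hr => ih r hr.2 ▸ h.2.1 r hr⟩
  · simp only [mem_between_add, leftOptions_zero, rightOptions_zero, Set.mem_empty_iff_false,
      false_imp_iff, implies_true, and_true]
    exact ⟨fun l hl => (ih l hl.2).trans_lt hl.1, fun r hr => hr.1.trans_eq (ih r hr.2).symm⟩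

protected theorem add_neg (x : No.{u}) : x + -x = 0 := by
  induction x using induction_strictlySimpler with
  | _ x ih =>
  refine simpler_zero_iff.1 ((isSimplest_add x (-x)).2 _ (mem_between_add.2 ⟨⟨?_, ?_⟩, ?_, ?_⟩))
  · exact fun l hl => ih l hl.2 ▸ add_lt_add_of_lt' (neg_lt_neg_of_lt hl.1) _
  · intro l hl
    have hr := neg_mem_rightOptions hl
    have := ih _ hr.2
    rw [neg_neg] at this
    exact this ▸ add_lt_add_of_lt hr.1 l
  · exact fun r hr => ih r hr.2 ▸ add_lt_add_of_lt' (neg_lt_neg_of_lt hr.1) _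
  · intro r hr
    have hl := neg_mem_leftOptions hr
    have := ih _ hl.2
    rw [neg_neg] at this
    exact this ▸ add_lt_add_of_lt hl.1 r

protected theorem add_le_add_left (h : x ≤ y) (z : No.{u}) : x + z ≤ y + z := by
  rcases h.eq_or_lt with rfl | h
  exacts [le_rfl, (add_lt_add_of_lt h z).le]

/-- The options of `(x + y) + z` that change `x + y` are dominated by options that change `x` or
`y`, since those dominate the canonical options of `x + y`. -/
theorem mem_between_add_add
    (hx : ∀ a, a.StrictlySimpler x → a + y + z = a + (y + z))
    (hy : ∀ b, b.StrictlySimpler y → x + b + z = x + (b + z))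
    (hz : ∀ c, c.StrictlySimpler z → x + y + c = x + (y + c)) :
    x + (y + z) ∈ between (addLeft (x + y) z) (addRight (x + y) z) := by
  refine mem_between_add.2 ⟨⟨fun l hl => ?_, fun l hl => ?_⟩, fun r hr => ?_, fun r hr => ?_⟩
  · obtain ⟨l', hl', hle⟩ := (isSimplest_add x y).exists_le_of_mem_leftOptions hl
    refine (No.add_le_add_left hle z).trans_lt ?_
    rcases hl' with ⟨a, ha, rfl⟩ | ⟨b, hb, rfl⟩
    · exact (hx a ha.2).trans_lt (add_lt_add_of_lt ha.1 _)
    · exact (hy b hb.2).trans_lt (add_lt_add_of_lt' (add_lt_add_of_lt hb.1 _) _)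
  · exact (hz l hl.2).trans_lt (add_lt_add_of_lt' (add_lt_add_of_lt' hl.1 _) _)
  · obtain ⟨r', hr', hle⟩ := (isSimplest_add x y).exists_le_of_mem_rightOptions hr
    refine lt_of_lt_of_le ?_ (No.add_le_add_left hle z)
    rcases hr' with ⟨a, ha, rfl⟩ | ⟨b, hb, rfl⟩
    · exact (add_lt_add_of_lt ha.1 _).trans_eq (hx a ha.2).symm
    · exact (add_lt_add_of_lt' (add_lt_add_of_lt hb.1 _) _).trans_eq (hy b hb.2).symm
  · exact (add_lt_add_of_lt' (add_lt_add_of_lt' hr.1 _) _).trans_eq (hz r hr.2).symm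

protected theorem add_assoc (x y z : No.{u}) : x + y + z = x + (y + z) := by
  induction x using induction_strictlySimpler generalizing y z with
  | _ x ihx =>
  induction y using induction_strictlySimpler generalizing z with
  | _ y ihy =>
  induction z using induction_strictlySimpler with
  | _ z ihz =>
  refine (isSimplest_add (x + y) z).eq (isSimplest_add x (y + z)) ?_
    (mem_between_add_add (fun a ha => ihx a ha y z) (fun b hb => ihy b hb z) ihz)
  -- the other half is the same statement for the reversed sums
  have h := mem_between_add_add (x := z) (y := y) (z := x)
    (fun a ha => ?_) (fun b hb => ?_) (fun c hc => ?_)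
  · rwa [No.add_comm z, No.add_comm z, No.add_comm y x, addLeft_comm, addRight_comm] at h
  · rw [No.add_comm a, No.add_comm _ x, No.add_comm a, No.add_comm y x]
    exact (ihz a ha).symm
  · rw [No.add_comm z, No.add_comm _ x, No.add_comm z, No.add_comm b x]
    exact (ihy b hb z).symm
  · rw [No.add_comm z, No.add_comm _ c, No.add_comm z, No.add_comm y c]
    exact (ihx c hc y z).symm

noncomputable instance : AddCommGroup No.{u} where
  add_assoc := No.add_assoc
  zero_add x := (No.add_comm 0 x).trans x.add_zero
  add_zero := No.add_zero
  neg_add_cancel x := (No.add_comm (-x) x).trans x.add_neg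
  add_comm := No.add_comm
  nsmul := nsmulRec
  zsmul := zsmulRec

instance : IsOrderedAddMonoid No.{u} where
  add_le_add_left _ _ h z := No.add_le_add_left h z

/-! ### Multiplication -/

/-- The typical option in the recursion for `x * y`. -/
noncomputable def mulOption (x y a b : No.{u}) : No.{u} :=
  a * y + x * b - a * b

/-- The left options in the recursion for `x * y`. -/
def mulLeft (x y : No.{u}) : Set No.{u} :=
  Set.image2 (mulOption x y) x.leftOptions y.leftOptions ∪
    Set.image2 (mulOption x y) x.rightOptions y.rightOptions

/-- The right options in the recursion for `x * y`. -/
def mulRight (x y : No.{u}) : Set No.{u} :=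
  Set.image2 (mulOption x y) x.leftOptions y.rightOptions ∪
    Set.image2 (mulOption x y) x.rightOptions y.leftOptions

theorem mul_eq_cut (x y : No.{u}) : x * y = cut (mulLeft x y) (mulRight x y) := by
  have e : ∀ s t : Set No.{u}, Set.image2 (mulOption x y) s t =
      Set.range fun p : s × t => mulOption x y p.1 p.2 := fun s t => by
    ext; simp [Set.mem_image2]
  change mul x y = _
  rw [mul, mulLeft, mulRight]
  simp only [e]
  rfl

theorem mem_between_mul : z ∈ between (mulLeft x y) (mulRight x y) ↔
    ((∀ a ∈ x.leftOptions, ∀ b ∈ y.leftOptions, a * y + x * b - a * b < z) ∧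
      ∀ a ∈ x.rightOptions, ∀ b ∈ y.rightOptions, a * y + x * b - a * b < z) ∧
    (∀ a ∈ x.leftOptions, ∀ b ∈ y.rightOptions, z < a * y + x * b - a * b) ∧
      ∀ a ∈ x.rightOptions, ∀ b ∈ y.leftOptions, z < a * y + x * b - a * b := by
  simp only [between, mulLeft, mulRight, mulOption, Set.mem_union, Set.mem_image2,
    Set.mem_ofPred_eq, or_imp, forall_and, forall_exists_index, and_imp]
  refine and_congr (and_congr ?_ ?_) (and_congr ?_ ?_) <;>
    exact ⟨fun h a ha b hb => h _ a ha b hb rfl, fun h _ a ha b hb e => e ▸ h a ha b hb⟩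

/-- If the products of `a`, `b` with `c`, `d` lie between their options, then `(b - a) * (d - c)`,
written out, is positive. -/
theorem mul_add_mul_lt {a b c d : No.{u}}
    (h : ∀ p ∈ ({a, b} : Set No.{u}), ∀ q ∈ ({c, d} : Set No.{u}),
      p * q ∈ between (mulLeft p q) (mulRight p q))
    (ha : a.Simpler x) (hb : b.Simpler x) (hab : a < b)
    (hc : c.Simpler y) (hd : d.Simpler y) (hcd : c < d) :
    a * d + b * c < a * c + b * d := by
  have h := fun p hp q hq => mem_between_mul.1 (h p hp q hq)
  rcases mem_options_of_lt ha hb hab with hx | hx <;>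
    rcases mem_options_of_lt hc hd hcd with hy | hy
  · have := (h b (by simp) d (by simp)).1.1 a hx c hy
    grind
  · have := (h b (by simp) c (by simp)).2.1 a hx d hy
    grind
  · have := (h a (by simp) d (by simp)).2.2 b hx c hy
    grind
  · have := (h a (by simp) c (by simp)).1.2 b hx d hy
    grind

theorem isSimplest_mul (x y : No.{u}) : IsSimplest (x * y) (mulLeft x y) (mulRight x y) := by
  induction x using induction_strictlySimpler generalizing y with
  | _ x ihx =>
  induction y using induction_strictlySimpler with
  | _ y ihy =>
  rw [mul_eq_cut]
  have : Small.{u} (mulLeft x y) := by unfold mulLeft; infer_instance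
  have : Small.{u} (mulRight x y) := by unfold mulRight; infer_instance
  -- positivity of rectangles one of whose sides joins proper initial segments of `x`, or of `y`,
  -- so that the product `x * y` does not occur and the inductive hypotheses apply
  have hX : ∀ {a b c d : No.{u}}, a.StrictlySimpler x → b.StrictlySimpler x → a < b →
      c.Simpler y → d.Simpler y → c < d → a * d + b * c < a * c + b * d := by
    intro a b c d ha hb hab hc hd
    refine mul_add_mul_lt ?_ (.inl ha) (.inl hb) hab hc hd
    rintro p (rfl | rfl) q -
    exacts [(ihx _ ha q).1, (ihx _ hb q).1]
  have hY : ∀ {a b c d : No.{u}}, a.Simpler x → b.Simpler x → a < b → c.StrictlySimpler y →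
      d.StrictlySimpler y → c < d → a * d + b * c < a * c + b * d := by
    intro a b c d ha hb hab hc hd
    refine mul_add_mul_lt ?_ ha hb hab (.inl hc) (.inl hd)
    rintro p hp q hq
    have hq' : q.StrictlySimpler y := by rcases hq with rfl | rfl <;> assumption
    have hp' : p.Simpler x := by rcases hp with rfl | rfl <;> assumption
    rcases hp' with hp' | rfl
    exacts [(ihx p hp' q).1, (ihy q hq').1]
  refine isSimplest_cut ?_
  rintro _ (⟨a, ha, c, hc, rfl⟩ | ⟨a, ha, c, hc, rfl⟩) _ (⟨b, hb, d, hd, rfl⟩ | ⟨b, hb, d, hd, rfl⟩)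
  -- each left option is compared with each right option through a third option, which takes one
  -- of its two entries from each of them, unless they have an entry in common already; the choice
  -- depends on the order of two entries on the same side of `x` or of `y`
  all_goals simp only [mulOption]
  · rcases lt_trichotomy a b with h | rfl | h
    · have h₁ := hX ha.2 hb.2 h (.inl hc.2) (.refl _) hc.1
      have h₂ := hY (.inl hb.2) (.refl _) hb.1 hc.2 hd.2 (hc.1.trans hd.1)
      grind
    · have h₁ := hY (.inl ha.2) (.refl _) ha.1 hc.2 hd.2 (hc.1.trans hd.1)
      grind
    · have h₁ := hY (.inl ha.2) (.refl _) ha.1 hc.2 hd.2 (hc.1.trans hd.1)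
      have h₂ := hX hb.2 ha.2 h (.refl _) (.inl hd.2) hd.1
      grind
  · rcases lt_trichotomy c d with h | rfl | h
    · have h₁ := hY (.inl ha.2) (.refl _) ha.1 hc.2 hd.2 h
      have h₂ := hX ha.2 hb.2 (ha.1.trans hb.1) (.inl hd.2) (.refl _) hd.1
      grind
    · have h₁ := hX ha.2 hb.2 (ha.1.trans hb.1) (.inl hc.2) (.refl _) hc.1
      grind
    · have h₁ := hX ha.2 hb.2 (ha.1.trans hb.1) (.inl hc.2) (.refl _) hc.1
      have h₂ := hY (.refl _) (.inl hb.2) hb.1 hd.2 hc.2 h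
      grind
  · rcases lt_trichotomy c d with h | rfl | h
    · have h₁ := hX hb.2 ha.2 (hb.1.trans ha.1) (.refl _) (.inl hc.2) hc.1
      have h₂ := hY (.inl hb.2) (.refl _) hb.1 hc.2 hd.2 h
      grind
    · have h₁ := hX hb.2 ha.2 (hb.1.trans ha.1) (.refl _) (.inl hc.2) hc.1
      grind
    · have h₁ := hY (.refl _) (.inl ha.2) ha.1 hd.2 hc.2 h
      have h₂ := hX hb.2 ha.2 (hb.1.trans ha.1) (.refl _) (.inl hd.2) hd.1
      grind
  · rcases lt_trichotomy a b with h | rfl | h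
    · have h₁ := hY (.refl _) (.inl ha.2) ha.1 hd.2 hc.2 (hd.1.trans hc.1)
      have h₂ := hX ha.2 hb.2 h (.inl hd.2) (.refl _) hd.1
      grind
    · have h₁ := hY (.refl _) (.inl ha.2) ha.1 hd.2 hc.2 (hd.1.trans hc.1)
      grind
    · have h₁ := hX hb.2 ha.2 h (.refl _) (.inl hc.2) hc.1
      have h₂ := hY (.refl _) (.inl hb.2) hb.1 hd.2 hc.2 (hd.1.trans hc.1)
      grind

/-! ### Initial classes -/

theorem IsInitial.neg {S : Set No.{u}} (hS : IsInitial S) :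
    IsInitial {z : No.{u} | ∃ x ∈ S, z = -x} := by
  rintro _ ⟨x, hx, rfl⟩ y hy
  exact ⟨-y, hS x hx _ (by simpa using hy.neg), (neg_neg y).symm⟩

theorem IsInitial.add {S U : Set No.{u}} (hS : IsInitial S) (hU : IsInitial U) :
    IsInitial {z : No.{u} | ∃ x ∈ S, ∃ y ∈ U, z = x + y} := by
  rintro _ ⟨x, hx, y, hy, rfl⟩
  induction x using induction_strictlySimpler generalizing y with
  | _ x ihx =>
  induction y using induction_strictlySimpler with
  | _ y ihy =>
  rintro z (hz | rfl)
  · have key : ∀ w ∈ addLeft x y ∪ addRight x y, z.Simpler w →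
        ∃ x ∈ S, ∃ y ∈ U, z = x + y := by
      rintro _ ((⟨a, ha, rfl⟩ | ⟨b, hb, rfl⟩) | (⟨a, ha, rfl⟩ | ⟨b, hb, rfl⟩)) hw
      · exact ihx a ha.2 (hS x hx a (.inl ha.2)) y hy z hw
      · exact ihy b hb.2 (hU y hy b (.inl hb.2)) z hw
      · exact ihx a ha.2 (hS x hx a (.inl ha.2)) y hy z hw
      · exact ihy b hb.2 (hU y hy b (.inl hb.2)) z hw
    rcases (isSimplest_add x y).exists_of_strictlySimpler hz with ⟨l, hl, -, h⟩ | ⟨r, hr, -, h⟩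
    exacts [key l (.inl hl) h, key r (.inr hr) h]
  · exact ⟨x, hx, y, hy, rfl⟩

theorem isInitial_segments (x : No.{u}) : IsInitial {y : No.{u} | y.Simpler x} :=
  fun _ hy _ hz => hz.trans hy

/-- The largest initial class contained in `G`. -/
def initialCore (G : Set No.{u}) : Set No.{u} :=
  {x | ∀ y : No.{u}, y.Simpler x → y ∈ G}

theorem initialCore_subset (G : Set No.{u}) : initialCore G ⊆ G :=
  fun x hx => hx x (.refl x)

theorem isInitial_initialCore (G : Set No.{u}) : IsInitial (initialCore G) :=
  fun _ hx _ hy _ hz => hx _ (hz.trans hy)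

theorem IsInitial.subset_initialCore {S G : Set No.{u}} (hS : IsInitial S) (h : S ⊆ G) :
    S ⊆ initialCore G :=
  fun x hx y hy => h (hS x hx y hy)

/-- Sums of initial classes being initial, the initial part of a subgroup is a subgroup. -/
theorem IsSubgroup.initialCore {G : Set No.{u}} (hG : IsSubgroup G) :
    IsSubgroup (initialCore G) where
  zero_mem y hy := simpler_zero_iff.1 hy ▸ hG.zero_mem
  add_mem x hx y hy z hz := by
    obtain ⟨a, ha, b, hb, rfl⟩ :=
      (isInitial_segments x).add (isInitial_segments y) _ ⟨x, .refl x, y, .refl y, rfl⟩ z hz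
    exact hG.add_mem a (hx a ha) b (hy b hb)
  neg_mem x hx z hz := by
    obtain ⟨a, ha, rfl⟩ := (isInitial_segments x).neg _ ⟨x, .refl x, rfl⟩ z hz
    exact hG.neg_mem a (hx a ha)

theorem isSubgroup_subgroupGenerated (S : Set No.{u}) : IsSubgroup (subgroupGenerated S) where
  zero_mem _ hT := hT.2.zero_mem
  add_mem x hx y hy T hT := hT.2.add_mem x (hx T hT) y (hy T hT)
  neg_mem x hx T hT := hT.2.neg_mem x (hx T hT)

theorem isSubring_subringGenerated (S : Set No.{u}) : IsSubring (subringGenerated S) where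
  zero_mem _ hT := hT.2.zero_mem
  add_mem x hx y hy T hT := hT.2.add_mem x (hx T hT) y (hy T hT)
  neg_mem x hx T hT := hT.2.neg_mem x (hx T hT)
  one_mem _ hT := hT.2.one_mem
  mul_mem x hx y hy T hT := hT.2.mul_mem x (hx T hT) y (hy T hT)

theorem isInitial_subgroupGenerated_of_subset {S : Set No.{u}}
    (h : S ⊆ initialCore (subgroupGenerated S)) : IsInitial (subgroupGenerated S) := by
  have hle : subgroupGenerated S ⊆ initialCore (subgroupGenerated S) :=
    Set.sInter_subset_of_mem ⟨h, (isSubgroup_subgroupGenerated S).initialCore⟩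
  exact (initialCore_subset _).antisymm hle ▸ isInitial_initialCore _

theorem IsInitial.subgroupGenerated {S : Set No.{u}} (hS : IsInitial S) :
    IsInitial (subgroupGenerated S) :=
  isInitial_subgroupGenerated_of_subset (hS.subset_initialCore fun _ hx _ hT => hT.1 hx)

/-- An initial segment of a product is an initial segment of one of the options of the product, and
the options are built from products of simpler elements of `S` and `U` by group operations. -/
theorem IsInitial.subgroupGenerated_mul {S U : Set No.{u}} (hS : IsInitial S) (hU : IsInitial U) :
    IsInitial (No.subgroupGenerated {z : No.{u} | ∃ x ∈ S, ∃ y ∈ U, z = x * y}) := by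
  refine isInitial_subgroupGenerated_of_subset ?_
  rintro _ ⟨x, hx, y, hy, rfl⟩
  set G := No.subgroupGenerated {z : No.{u} | ∃ x ∈ S, ∃ y ∈ U, z = x * y}
  have hC : IsSubgroup (initialCore G) := (isSubgroup_subgroupGenerated _).initialCore
  induction x using induction_strictlySimpler generalizing y with
  | _ x ihx =>
  induction y using induction_strictlySimpler with
  | _ y ihy =>
  rintro z (hz | rfl)
  · have option_mem : ∀ a, a.StrictlySimpler x → ∀ b, b.StrictlySimpler y →
        mulOption x y a b ∈ initialCore G := fun a ha b hb => by
      have haS := hS x hx a (.inl ha)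
      have hbU := hU y hy b (.inl hb)
      rw [mulOption, sub_eq_add_neg]
      exact hC.add_mem _ (hC.add_mem _ (ihx a ha haS y hy) _ (ihy b hb hbU)) _
        (hC.neg_mem _ (ihx a ha haS b hbU))
    have key : ∀ w ∈ mulLeft x y ∪ mulRight x y, w ∈ initialCore G := by
      rintro _ ((⟨a, ha, b, hb, rfl⟩ | ⟨a, ha, b, hb, rfl⟩) |
        (⟨a, ha, b, hb, rfl⟩ | ⟨a, ha, b, hb, rfl⟩)) <;> exact option_mem a ha.2 b hb.2
    rcases (isSimplest_mul x y).exists_of_strictlySimpler hz with ⟨l, hl, -, h⟩ | ⟨r, hr, -, h⟩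
    exacts [key l (.inl hl) z h, key r (.inr hr) z h]
  · exact fun T hT => hT.1 ⟨x, hx, y, hy, rfl⟩

/-- The initial part of a subring is a subring: an initial segment of `x * y` is a sum of products
of initial segments of `x` and `y`, up to sign. -/
theorem IsSubring.initialCore {A : Set No.{u}} (hA : IsSubring A) :
    IsSubring (initialCore A) where
  toIsSubgroup := hA.toIsSubgroup.initialCore
  one_mem y hy := by
    rcases simpler_one_iff.1 hy with rfl | rfl
    exacts [hA.zero_mem, hA.one_mem]
  mul_mem x hx y hy z hz := by
    have hz' := (isInitial_segments x).subgroupGenerated_mul (isInitial_segments y) (x * y)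
      (fun T hT => hT.1 ⟨x, .refl x, y, .refl y, rfl⟩) z hz
    refine hz' A ⟨?_, hA.toIsSubgroup⟩
    rintro _ ⟨a, ha, b, hb, rfl⟩
    exact hA.mul_mem a (hx a ha) b (hy b hb)

theorem IsInitial.subringGenerated {S : Set No.{u}} (hS : IsInitial S) :
    IsInitial (subringGenerated S) := by
  have hle : No.subringGenerated S ⊆ initialCore (No.subringGenerated S) :=
    Set.sInter_subset_of_mem ⟨hS.subset_initialCore fun _ hx _ hT => hT.1 hx,
      (isSubring_subringGenerated S).initialCore⟩
  exact (initialCore_subset _).antisymm hle ▸ isInitial_initialCore _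

end No

theorem mainTheorem9 (S U : Set No.{u}) (hS : No.IsInitial S) (hU : No.IsInitial U) :
    No.IsInitial (No.subgroupGenerated S) ∧
    No.IsInitial (No.subringGenerated S) ∧
    No.IsInitial {z : No.{u} | ∃ x ∈ S, z = -x} ∧
    No.IsInitial {z : No.{u} | ∃ x ∈ S, ∃ y ∈ U, z = x + y} ∧
    No.IsInitial (No.subgroupGenerated {z : No.{u} | ∃ x ∈ S, ∃ y ∈ U, z = x * y}) :=
  ⟨hS.subgroupGenerated, hS.subringGenerated, hS.neg, hS.add hU, hS.subgroupGenerated_mul hU⟩
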